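/- Let $\mathbb{B}^2=\{z\in\mathbb{C}:|z|<1\}$ be the Poincaré disk with the hyperbolic metric $g_z=\frac{4}{(1-|z|^2)^2}|dz|^2$, Levi-Civita connection $\nabla$ and complex structure $\mathrm{J}$ (multiplication by $i$). Under the splitting $\mathrm{T}_{(x,v)}\mathrm{T}\mathbb{B}^2\cong \mathrm{T}_x\mathbb{B}^2\oplus \mathrm{T}_x\mathbb{B}^2$ into horizontal and vertical components defined by $\nabla$, equip $\mathrm{T}\mathbb{B}^2$ with the pseudo-Riemannian metric $\mathbb{G}((X_1,X_2),(Y_1,Y_2))=g(X_1,Y_2)+g(X_2,Y_1)$ and the symplectic form $\Omega((X_1,X_2),(Y_1,Y_2))=g(\mathrm{J}X_1,Y_2)-g(X_2,\mathrm{J}Y_1)$. A smooth vector field $V$ on $\mathbb{B}^2$ is called harmonic Lagrangian if $V:(\mathbb{B}^2,g)\to(\mathrm{T}\mathbb{B}^2,\mathbb{G})$ is a harmonic map (its tension field, formed with the Levi-Civita connections of $g$ and $\mathbb{G}$, vanishes) and $V(\mathbb{B}^2)$ is a Lagrangian surface for $\Omega$. Proposition 5.4. Let $X$ be a continuous (tangent)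 vector field on the unit circle $\mathbb{S}^1\subset\mathbb{C}$, regarded as a continuous function $X:\mathbb{S}^1\to\mathbb{C}$ with $\mathrm{Re}(\overline{x}X(x))=0$ for all $x\in\mathbb{S}^1$, and let $$L_0(X)(z)=\frac{(1-|z|^2)^3}{2i\pi}\int_{\mathbb{S}^1}\frac{X(x)}{(1-\overline{z}x)^3(x-z)}\,dx,\qquad z\in\mathbb{B}^2,$$ be its infinitesimal Douady–Earle extension. Then $L_0(X)$ is a (smooth) harmonic Lagrangian vector field on $\mathbb{B}^2$. In particular $\overline{\Delta}L_0(X)=L_0(X)$ and $\mathrm{div}\,L_0(X)=0$ on $\mathbb{B}^2$, where $\overline{\Delta}V=\sum_{i=1}^{2}(\nabla_{e_i}\nabla_{e_i}V-\nabla_{\nabla_{e_i}e_i}V)$ and $\mathrm{div}\,V=\sum_{i=1}^2 g(\nabla_{e_i}V,e_i)$ for an orthonormal frame $(e_1,e_2)$ of $g$. -/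

import Mathlib

open scoped ContDiff ComplexConjugate

noncomputable section

/-! ### Pseudo-Riemannian geometry in one global chart

A (pseudo-)Riemannian metric on an open subset of a finite-dimensional real vector space `E` is
written as a function `g : E → E → E → ℝ`, where `g x v w` is the product at the point `x` of the
tangent vectors `v` and `w`. Only the values of `g` on the open subset matter. -/

section Chart

/-- The right-hand side of the Koszul formula for constant vector fields `v`, `w`, `u`
(the Christoffel symbols of the first kind). -/
def koszulForm {E : Type*} [NormedAddCommGroup E] [NormedSpace ℝ E]
    (g : E → E → E → ℝ) (x v w u : E) : ℝ :=
  (fderiv ℝ (fun y => g y w u) x v + fderiv ℝ (fun y => g y v u) x w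
    - fderiv ℝ (fun y => g y v w) x u) / 2

/-- The Christoffel symbols `Γ_x(v, w)` of the Levi-Civita connection of `g`: the vector `ξ` with
`g_x(ξ, u) = koszulForm g x v w u` for all `u`, which exists and is unique as `g_x` is
nondegenerate. -/
def christoffel {E : Type*} [NormedAddCommGroup E] [NormedSpace ℝ E]
    (g : E → E → E → ℝ) (x v w : E) : E :=
  Classical.epsilon fun ξ : E => ∀ u : E, g x ξ u = koszulForm g x v w u

/-- The vector defining `christoffel` is unique when `g_x` is additive and nondegenerate. -/
theorem christoffel_eq {E : Type*} [NormedAddCommGroup E] [NormedSpace ℝ E]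
    {g : E → E → E → ℝ} {x v w ξ : E}
    (hsub : ∀ a b u : E, g x (a - b) u = g x a u - g x b u)
    (hnd : ∀ a : E, (∀ u : E, g x a u = 0) → a = 0)
    (hξ : ∀ u : E, g x ξ u = koszulForm g x v w u) :
    christoffel g x v w = ξ := by
  have h : ∀ u : E, g x (christoffel g x v w) u = koszulForm g x v w u :=
    Classical.epsilon_spec (p := fun ξ : E => ∀ u : E, g x ξ u = koszulForm g x v w u) ⟨ξ, hξ⟩
  exact sub_eq_zero.mp (hnd _ fun u => by rw [hsub, h u, hξ u, sub_self])

/-- The Levi-Civita covariant derivative `∇_X Y` of `g`. -/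
def covDeriv {E : Type*} [NormedAddCommGroup E] [NormedSpace ℝ E]
    (g : E → E → E → ℝ) (X Y : E → E) (x : E) : E :=
  fderiv ℝ Y x (X x) + christoffel g x (X x) (Y x)

/-- The covariant derivative, in the direction `X`, of a vector field `s` along the map `F`, for
the pullback by `F` of the Levi-Civita connection of the metric `h` on the target. -/
def covDerivAlong {E E' : Type*} [NormedAddCommGroup E] [NormedSpace ℝ E]
    [NormedAddCommGroup E'] [NormedSpace ℝ E']
    (h : E' → E' → E' → ℝ) (F : E → E') (X : E → E) (s : E → E') (x : E) : E' :=
  fderiv ℝ s x (X x) + christoffel h (F x) (fderiv ℝ F x (X x)) (s x)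

/-- The second fundamental form of a map `F : (E, g) → (E', h)`:
`∇²F(X, Y) = ∇_{dF(X)} dF(Y) - dF(∇_X Y)`. -/
def mapHessian {E E' : Type*} [NormedAddCommGroup E] [NormedSpace ℝ E]
    [NormedAddCommGroup E'] [NormedSpace ℝ E']
    (g : E → E → E → ℝ) (h : E' → E' → E' → ℝ) (F : E → E') (X Y : E → E) (x : E) : E' :=
  covDerivAlong h F X (fun y => fderiv ℝ F y (Y y)) x - fderiv ℝ F x (covDeriv g X Y x)

end Chart

/-! ### The Poincaré disk `𝔹²` -/

/-- The open unit disk of `ℂ`, the underlying space of `𝔹²`. -/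
def poincareDisk : Set ℂ := Metric.ball 0 1

/-- The hyperbolic metric `4 / (1 - |z|²)²` times the Euclidean metric. -/
def hypMetric (z v w : ℂ) : ℝ := 4 / (1 - ‖z‖ ^ 2) ^ 2 * inner ℝ v w

/-- The global orthonormal frame `e₁ = (1 - |z|²)/2 · ∂/∂x`, `e₂ = (1 - |z|²)/2 · ∂/∂y` of `𝔹²`. -/
def hypFrame (i : Fin 2) (z : ℂ) : ℂ := ((1 - ‖z‖ ^ 2) / 2 : ℝ) • ![1, Complex.I] i

theorem hypFrame_orthonormal {z : ℂ} (hz : z ∈ poincareDisk) (i j : Fin 2) :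
    hypMetric z (hypFrame i z) (hypFrame j z) = if i = j then 1 else 0 := by
  have h1 : ‖z‖ < 1 := by simpa [poincareDisk] using hz
  have h2 : (1 - ‖z‖ ^ 2) ≠ 0 := by nlinarith [norm_nonneg z]
  simp only [hypMetric, hypFrame, inner_smul_left, inner_smul_right]
  fin_cases i <;> fin_cases j <;> simp [Complex.inner] <;> field_simp <;> norm_num

/-- The complex structure `J` of `𝔹²` is multiplication by `i`. -/
def hypJ (v : ℂ) : ℂ := Complex.I * v

/-- `div V = ∑ᵢ g(∇_{eᵢ} V, eᵢ)`. -/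
def hypDiv (V : ℂ → ℂ) (z : ℂ) : ℝ :=
  ∑ i : Fin 2, hypMetric z (covDeriv hypMetric (hypFrame i) V z) (hypFrame i z)

/-- The rough Laplacian `∑ᵢ (∇_{eᵢ} ∇_{eᵢ} V - ∇_{∇_{eᵢ} eᵢ} V)`. -/
def roughLaplacian (V : ℂ → ℂ) (z : ℂ) : ℂ :=
  ∑ i : Fin 2,
    (covDeriv hypMetric (hypFrame i) (covDeriv hypMetric (hypFrame i) V) z
      - covDeriv hypMetric (covDeriv hypMetric (hypFrame i) (hypFrame i)) V z)

/-- The tension field of a map from `𝔹²` to a pseudo-Riemannian manifold with metric `h`. -/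
def tensionField {E' : Type*} [NormedAddCommGroup E'] [NormedSpace ℝ E']
    (h : E' → E' → E' → ℝ) (F : ℂ → E') (z : ℂ) : E' :=
  ∑ i : Fin 2, mapHessian hypMetric h F (hypFrame i) (hypFrame i) z

/-- A map from `𝔹²` to a pseudo-Riemannian manifold is harmonic if it is smooth and its tension
field vanishes. -/
def IsHarmonicMap {E' : Type*} [NormedAddCommGroup E'] [NormedSpace ℝ E']
    (h : E' → E' → E' → ℝ) (F : ℂ → E') : Prop :=
  ContDiffOn ℝ ∞ F poincareDisk ∧ ∀ z ∈ poincareDisk, tensionField h F z = 0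

/-! ### The tangent bundle `T𝔹² = 𝔹² × ℂ`

A point is a pair `(x, v)` and a tangent vector at it is a pair `(a, b)` in `ℂ × ℂ`. -/

/-- The vertical lift of `w ∈ T_x 𝔹²` at `p = (x, v)`: the derivative of `t ↦ (x, v + t w)`. -/
def verticalLift (w : ℂ) : ℂ × ℂ := (0, w)

/-- The horizontal lift of `w ∈ T_x 𝔹²` at `p = (x, v)`: the initial velocity of `(c(t), V(t))`,
where `c` starts at `x` with velocity `w` and `V` is parallel along `c` with `V(0) = v`, that is
`V' = - Γ_c(c', V)`. -/
def horizontalLift (p : ℂ × ℂ) (w : ℂ) : ℂ × ℂ := (w, -christoffel hypMetric p.1 w p.2)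

/-- The horizontal component of a tangent vector of `T𝔹²` (the derivative of the projection). -/
def horPart (ξ : ℂ × ℂ) : ℂ := ξ.1

/-- The vertical component of a tangent vector of `T𝔹²` at `p`. -/
def verPart (p ξ : ℂ × ℂ) : ℂ := ξ.2 + christoffel hypMetric p.1 ξ.1 p.2

theorem lift_decomposition (p ξ : ℂ × ℂ) (w₁ w₂ : ℂ) :
    ξ = horizontalLift p w₁ + verticalLift w₂ ↔ w₁ = horPart ξ ∧ w₂ = verPart p ξ := by
  obtain ⟨a, b⟩ := ξ
  simp only [horizontalLift, verticalLift, horPart, verPart, Prod.mk_add_mk, Prod.mk.injEq,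
    add_zero]
  constructor
  · rintro ⟨rfl, rfl⟩
    exact ⟨rfl, by ring⟩
  · rintro ⟨rfl, rfl⟩
    exact ⟨rfl, by ring⟩

/-- The pseudo-Riemannian metric `𝔾` of signature `(2, 2)` on `T𝔹²`:
`𝔾((X₁, X₂), (Y₁, Y₂)) = g(X₁, Y₂) + g(X₂, Y₁)` in horizontal and vertical components. -/
def tangentMetric (p ξ η : ℂ × ℂ) : ℝ :=
  hypMetric p.1 (horPart ξ) (verPart p η) + hypMetric p.1 (verPart p ξ) (horPart η)

/-- The symplectic form `Ω` on `T𝔹²`: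
`Ω((X₁, X₂), (Y₁, Y₂)) = g(J X₁, Y₂) - g(X₂, J Y₁)` in horizontal and vertical components. -/
def tangentSymplectic (p ξ η : ℂ × ℂ) : ℝ :=
  hypMetric p.1 (hypJ (horPart ξ)) (verPart p η) - hypMetric p.1 (verPart p ξ) (hypJ (horPart η))

/-- A vector field on `𝔹²`, given by its component `V : ℂ → ℂ`, as a map `𝔹² → T𝔹²`. -/
def toSection (V : ℂ → ℂ) (z : ℂ) : ℂ × ℂ := (z, V z)

/-- The image `V(𝔹²)` is a Lagrangian surface of `(T𝔹², Ω)`: at each of its points its tangent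
space, the range of the differential of `z ↦ (z, V z)`, is of dimension two (half of four) and
`Ω` vanishes on it. -/
def HasLagrangianImage (V : ℂ → ℂ) : Prop :=
  ∀ z ∈ poincareDisk,
    Module.finrank ℝ (LinearMap.range (fderiv ℝ (toSection V) z).toLinearMap) = 2 ∧
    ∀ a b : ℂ, tangentSymplectic (toSection V z)
      (fderiv ℝ (toSection V) z a) (fderiv ℝ (toSection V) z b) = 0

/-- Harmonic Lagrangian vector fields on `𝔹²`: smooth vector fields `V` that are harmonic as maps
`(𝔹², g) → (T𝔹², 𝔾)` and whose image is a Lagrangian surface. -/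
def IsHarmonicLagrangian (V : ℂ → ℂ) : Prop :=
  ContDiffOn ℝ ∞ V poincareDisk ∧ IsHarmonicMap tangentMetric (toSection V) ∧ HasLagrangianImage V

/-! ### The infinitesimal Douady–Earle extension -/

/-- Continuous (tangent) vector fields on the unit circle, as functions of which only the values
on the circle matter. -/
def IsContinuousCircleField (X : ℂ → ℂ) : Prop :=
  ContinuousOn X (Metric.sphere 0 1) ∧ ∀ x ∈ Metric.sphere (0 : ℂ) 1, inner ℝ x (X x) = 0

/-- `L₀(X)(z) = (1 - |z|²)³ / (2πi) ∮ X(x) / ((1 - z̄ x)³ (x - z)) dx` over the unit circle. -/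
def douadyEarle (X : ℂ → ℂ) (z : ℂ) : ℂ :=
  ((1 - ‖z‖ ^ 2 : ℝ) : ℂ) ^ 3 / (2 * Real.pi * Complex.I)
    * ∮ x in C(0, 1), X x / ((1 - conj z * x) ^ 3 * (x - z))

end

noncomputable section

/-! Write `V` for the extension, `A = 1 - |z|²`, `p = ∂V/∂z`, `q = ∂V/∂z̄`. The Christoffel symbols
of the disk are complex bilinear, so `∇V` has complex-linear part `P = p + 2 z̄ V / A` and
antilinear part `q`. The divergence is `2 Re P`, and the graph of `V` is Lagrangian when `Re P = 0`.
The vertical part of the tension field is `A² (∂q/∂z + 2 z̄ q / A)`, its horizontal part is zero,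
and the rough Laplacian is this vertical part plus `V`. So everything reduces to two facts: `Re P =
0`, and `∂(A⁻² q)/∂z = 0`.

Both are read off from the kernel (`hasWirtingerAt_douadyEarle`). Differentiating under the integral
and simplifying gives `P = A²/(2πi) ∮ X / ((1 - z̄x)² (x - z)²) dx` and `q = 3A²/(2πi) ∮ X / (1 -
z̄x)⁴ dx`. The second integral is antiholomorphic in `z`. In the first, tangency of `X` makes the
integral real (`im_kernelIntegral_of_tangent`), so `P` is imaginary. -/

/-! ### Wirtinger derivatives -/

/-- The real-linear map `a ↦ p a + q ā`. -/
def wirtingerMap (p q : ℂ) : ℂ →L[ℝ] ℂ :=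
  p • (1 : ℂ →L[ℝ] ℂ) + q • (Complex.conjCLE : ℂ →L[ℝ] ℂ)

@[simp]
theorem wirtingerMap_apply (p q a : ℂ) : wirtingerMap p q a = p * a + q * conj a := by
  simp [wirtingerMap]

/-- `f` is real differentiable at `z`, with `∂f/∂z = p` and `∂f/∂z̄ = q`. -/
def HasWirtingerAt (f : ℂ → ℂ) (p q z : ℂ) : Prop :=
  HasFDerivAt f (wirtingerMap p q) z

namespace HasWirtingerAt

variable {f g : ℂ → ℂ} {p q p' q' z : ℂ}

theorem fderiv_apply (h : HasWirtingerAt f p q z) (a : ℂ) :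
    fderiv ℝ f z a = p * a + q * conj a := by
  rw [HasFDerivAt.fderiv h, wirtingerMap_apply]

theorem of_hasFDerivAt {L : ℂ →L[ℝ] ℂ} (h : HasFDerivAt f L z)
    (hL : ∀ a, L a = p * a + q * conj a) : HasWirtingerAt f p q z := by
  have : wirtingerMap p q = L := ContinuousLinearMap.ext fun a => by rw [wirtingerMap_apply, hL]
  rwa [HasWirtingerAt, this]

theorem congr_coeff (h : HasWirtingerAt f p q z) (hp : p = p') (hq : q = q') :
    HasWirtingerAt f p' q' z := hp ▸ hq ▸ h

theorem of_differentiableAt (h : DifferentiableAt ℝ f z) :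
    ∃ p q, HasWirtingerAt f p q z := by
  -- These are the classical `(f_x - i f_y)/2` and `(f_x + i f_y)/2`.
  refine ⟨(fderiv ℝ f z 1 - Complex.I * fderiv ℝ f z Complex.I) / 2,
    (fderiv ℝ f z 1 + Complex.I * fderiv ℝ f z Complex.I) / 2,
    of_hasFDerivAt h.hasFDerivAt fun a => ?_⟩
  have ha : a = a.re • (1 : ℂ) + a.im • Complex.I := by
    simp [Complex.re_add_im]
  have h1 : a = a.re + a.im * Complex.I := (Complex.re_add_im a).symm
  have h2 : conj a = a.re - a.im * Complex.I := by
    apply Complex.ext <;> simp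
  conv_lhs => rw [ha, map_add, map_smul, map_smul]
  rw [h2]
  nth_rewrite 3 [h1]
  simp only [Complex.real_smul]
  linear_combination ((a.im : ℂ) * fderiv ℝ f z Complex.I) * Complex.I_sq

theorem const (c z : ℂ) : HasWirtingerAt (fun _ => c) 0 0 z :=
  of_hasFDerivAt (hasFDerivAt_const (𝕜 := ℝ) c z) (by simp)

theorem self (z : ℂ) : HasWirtingerAt (fun y => y) 1 0 z :=
  of_hasFDerivAt (hasFDerivAt_id (𝕜 := ℝ) z) (by simp)

theorem star_self (z : ℂ) : HasWirtingerAt (fun y => conj y) 0 1 z :=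
  of_hasFDerivAt (Complex.conjCLE : ℂ →L[ℝ] ℂ).hasFDerivAt (by simp)

theorem add (hf : HasWirtingerAt f p q z) (hg : HasWirtingerAt g p' q' z) :
    HasWirtingerAt (fun y => f y + g y) (p + p') (q + q') z :=
  of_hasFDerivAt (HasFDerivAt.add hf hg) fun a => by simp; ring

theorem sub (hf : HasWirtingerAt f p q z) (hg : HasWirtingerAt g p' q' z) :
    HasWirtingerAt (fun y => f y - g y) (p - p') (q - q') z :=
  of_hasFDerivAt (HasFDerivAt.sub hf hg) fun a => by simp; ring

theorem mul (hf : HasWirtingerAt f p q z) (hg : HasWirtingerAt g p' q' z) :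
    HasWirtingerAt (fun y => f y * g y) (p * g z + f z * p') (q * g z + f z * q') z :=
  of_hasFDerivAt (HasFDerivAt.mul hf hg) fun a => by simp; ring

theorem const_mul (c : ℂ) (hf : HasWirtingerAt f p q z) :
    HasWirtingerAt (fun y => c * f y) (c * p) (c * q) z :=
  ((const c z).mul hf).congr_coeff (by simp) (by simp)

theorem inv (hf : HasWirtingerAt f p q z) (h0 : f z ≠ 0) :
    HasWirtingerAt (fun y => (f y)⁻¹) (-p * (f z)⁻¹ ^ 2) (-q * (f z)⁻¹ ^ 2) z :=
  of_hasFDerivAt (((hasDerivAt_inv h0).hasFDerivAt.restrictScalars ℝ).comp z hf)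
    fun a => by simp; ring

theorem pow (hf : HasWirtingerAt f p q z) (n : ℕ) :
    HasWirtingerAt (fun y => f y ^ n) (n * f z ^ (n - 1) * p) (n * f z ^ (n - 1) * q) z :=
  of_hasFDerivAt (((hasDerivAt_pow n (f z)).hasFDerivAt.restrictScalars ℝ).comp z hf)
    fun a => by simp; ring

/-- Differentiation under the integral sign on the unit circle. -/
theorem circleIntegral {G P Q : ℂ → ℂ → ℂ} {U : Set ℂ} (hU : IsOpen U)
    (hG : ∀ z ∈ U, ContinuousOn (G z) (Metric.sphere 0 1))
    (hP : ContinuousOn (Function.uncurry P) (U ×ˢ Metric.sphere 0 1))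
    (hQ : ContinuousOn (Function.uncurry Q) (U ×ˢ Metric.sphere 0 1))
    (h : ∀ z ∈ U, ∀ x ∈ Metric.sphere (0 : ℂ) 1,
      HasWirtingerAt (fun z => G z x) (P z x) (Q z x) z) (hz : z ∈ U) :
    HasWirtingerAt (fun z => ∮ x in C(0, 1), G z x) (∮ x in C(0, 1), P z x)
      (∮ x in C(0, 1), Q z x) z := by
  -- Compactness of (closed ball) × circle bounds `P` and `Q` uniformly, so a constant dominates the
  -- derivative of the integrand.
  obtain ⟨r, hr, hrU⟩ := Metric.nhds_basis_closedBall.mem_iff.mp (hU.mem_nhds hz)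
  have hK : IsCompact (Metric.closedBall z r ×ˢ Metric.sphere (0 : ℂ) 1) :=
    (isCompact_closedBall z r).prod (isCompact_sphere 0 1)
  have hsub : Metric.closedBall z r ×ˢ Metric.sphere (0 : ℂ) 1 ⊆ U ×ˢ Metric.sphere 0 1 :=
    Set.prod_mono hrU le_rfl
  obtain ⟨B, hB⟩ := hK.exists_bound_of_continuousOn (hP.mono hsub)
  obtain ⟨B', hB'⟩ := hK.exists_bound_of_continuousOn (hQ.mono hsub)
  have hmem (θ : ℝ) : circleMap 0 1 θ ∈ Metric.sphere (0 : ℂ) 1 :=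
    circleMap_mem_sphere 0 zero_le_one θ
  have hc : Continuous (circleMap 0 1) := continuous_circleMap 0 1
  have hcd : Continuous (deriv (circleMap 0 1)) := by
    simp only [funext (deriv_circleMap 0 1)]
    exact hc.mul continuous_const
  have cont {F : ℂ → ℂ} (hF : ContinuousOn F (Metric.sphere 0 1)) :
      Continuous fun θ => deriv (circleMap 0 1) θ * F (circleMap 0 1 θ) :=
    hcd.mul (hF.comp_continuous hc hmem)
  have hPz : ContinuousOn (P z) (Metric.sphere 0 1) :=
    hP.comp (f := fun x => (z, x)) (by fun_prop) fun x hx => ⟨hz, hx⟩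
  have hQz : ContinuousOn (Q z) (Metric.sphere 0 1) :=
    hQ.comp (f := fun x => (z, x)) (by fun_prop) fun x hx => ⟨hz, hx⟩
  have hwc {F F' : ℝ → ℂ} (hF : Continuous F) (hF' : Continuous F') :
      Continuous fun θ => wirtingerMap (F θ) (F' θ) := by
    unfold wirtingerMap
    fun_prop
  have main := intervalIntegral.hasFDerivAt_integral_of_dominated_of_fderiv_le
    (μ := MeasureTheory.volume) (a := 0) (b := 2 * Real.pi) (𝕜 := ℝ)
    (F := fun z θ => deriv (circleMap 0 1) θ * G z (circleMap 0 1 θ))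
    (F' := fun z θ => wirtingerMap (deriv (circleMap 0 1) θ * P z (circleMap 0 1 θ))
      (deriv (circleMap 0 1) θ * Q z (circleMap 0 1 θ)))
    (x₀ := z) (s := Metric.closedBall z r) (bound := fun _ => B + B')
    (Metric.closedBall_mem_nhds z hr)
    (Filter.eventually_of_mem (hU.mem_nhds hz) fun y hy =>
      (cont (hG y hy)).aestronglyMeasurable)
    ((cont (hG z hz)).intervalIntegrable _ _)
    (hwc (cont hPz) (cont hQz)).aestronglyMeasurable
    (Filter.Eventually.of_forall fun θ _ y hy => by
      have hB1 := hB (y, circleMap 0 1 θ) ⟨hy, hmem θ⟩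
      have hB2 := hB' (y, circleMap 0 1 θ) ⟨hy, hmem θ⟩
      simp only [Function.uncurry_apply_pair] at hB1 hB2
      have hd : ‖deriv (circleMap 0 1) θ‖ = 1 := by simp [deriv_circleMap]
      refine ContinuousLinearMap.opNorm_le_bound _
        (add_nonneg ((norm_nonneg _).trans hB1) ((norm_nonneg _).trans hB2)) fun a => ?_
      rw [wirtingerMap_apply, add_mul]
      refine (norm_add_le _ _).trans (add_le_add ?_ ?_)
      · rw [norm_mul, norm_mul, hd, one_mul]
        gcongr
      · rw [norm_mul, norm_mul, hd, one_mul, RCLike.norm_conj]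
        gcongr)
    intervalIntegrable_const
    (Filter.Eventually.of_forall fun θ _ y hy =>
      (h y (hrU hy) _ (hmem θ)).const_mul (deriv (circleMap 0 1) θ))
  have hint : (∫ θ in (0 : ℝ)..2 * Real.pi,
      wirtingerMap (deriv (circleMap 0 1) θ * P z (circleMap 0 1 θ))
        (deriv (circleMap 0 1) θ * Q z (circleMap 0 1 θ))) =
      wirtingerMap (∮ x in C(0, 1), P z x) (∮ x in C(0, 1), Q z x) := by
    refine ContinuousLinearMap.ext fun a => ?_
    rw [ContinuousLinearMap.intervalIntegral_apply
      ((hwc (cont hPz) (cont hQz)).intervalIntegrable _ _)]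
    simp only [wirtingerMap_apply, _root_.circleIntegral, smul_eq_mul]
    rw [intervalIntegral.integral_add
      (((cont hPz).intervalIntegrable _ _).mul_const a)
      (((cont hQz).intervalIntegrable _ _).mul_const (conj a)),
      intervalIntegral.integral_mul_const, intervalIntegral.integral_mul_const]
  rw [hint] at main
  exact main

end HasWirtingerAt

/-! ### Circle integrals with kernels `(1 - z̄ x)⁻ⁿ (x - z)⁻ˡ` -/

theorem isOpen_poincareDisk : IsOpen poincareDisk := Metric.isOpen_ball

theorem one_sub_conj_mul_ne_zero {z x : ℂ} (hz : z ∈ poincareDisk)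
    (hx : x ∈ Metric.sphere (0 : ℂ) 1) : 1 - conj z * x ≠ 0 := by
  intro h
  have h1 : ‖z‖ < 1 := by simpa [poincareDisk] using hz
  have h2 : ‖x‖ = 1 := by simpa using hx
  have h3 : ‖conj z * x‖ = 1 := by rw [← sub_eq_zero.mp h, norm_one]
  rw [norm_mul, RCLike.norm_conj, h2, mul_one] at h3
  exact h1.ne h3

theorem sub_ne_zero_of_mem_poincareDisk {z x : ℂ} (hz : z ∈ poincareDisk)
    (hx : x ∈ Metric.sphere (0 : ℂ) 1) : x - z ≠ 0 := by
  intro h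
  have h1 : ‖z‖ < 1 := by simpa [poincareDisk] using hz
  have h2 : ‖x‖ = 1 := by simpa using hx
  rw [sub_eq_zero.mp h] at h2
  exact h1.ne h2

theorem one_sub_mul_conj_ne_zero {z : ℂ} (hz : z ∈ poincareDisk) : 1 - z * conj z ≠ 0 := by
  have h1 : ‖z‖ < 1 := by simpa [poincareDisk] using hz
  rw [Complex.mul_conj']
  norm_cast
  nlinarith [norm_nonneg z]

/-- The integrand `X(x) xᵐ (1 - z̄ x)⁻ⁿ (x - z)⁻ˡ`. -/
def kernelIntegrand (X : ℂ → ℂ) (m n l : ℕ) (z x : ℂ) : ℂ :=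
  X x * x ^ m * (1 - conj z * x)⁻¹ ^ n * (x - z)⁻¹ ^ l

/-- The circle integral of `kernelIntegrand`. -/
def kernelIntegral (X : ℂ → ℂ) (m n l : ℕ) (z : ℂ) : ℂ :=
  ∮ x in C(0, 1), kernelIntegrand X m n l z x

section

variable {X : ℂ → ℂ} (hX : ContinuousOn X (Metric.sphere 0 1)) (m n l : ℕ)
include hX

theorem continuousOn_uncurry_kernelIntegrand :
    ContinuousOn (Function.uncurry (kernelIntegrand X m n l))
      (poincareDisk ×ˢ Metric.sphere 0 1) := by
  have h1 : ContinuousOn (fun y : ℂ × ℂ => X y.2) (poincareDisk ×ˢ Metric.sphere 0 1) :=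
    hX.comp continuousOn_snd fun y hy => hy.2
  have h2 : ContinuousOn (fun y : ℂ × ℂ => (1 - conj y.1 * y.2)⁻¹)
      (poincareDisk ×ˢ Metric.sphere 0 1) :=
    ContinuousOn.inv₀ (by fun_prop) fun y hy => one_sub_conj_mul_ne_zero hy.1 hy.2
  have h3 : ContinuousOn (fun y : ℂ × ℂ => (y.2 - y.1)⁻¹)
      (poincareDisk ×ˢ Metric.sphere 0 1) :=
    ContinuousOn.inv₀ (by fun_prop) fun y hy => sub_ne_zero_of_mem_poincareDisk hy.1 hy.2
  exact ((h1.mul (continuousOn_snd.pow m)).mul (h2.pow n)).mul (h3.pow l)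

theorem continuousOn_kernelIntegrand {z : ℂ} (hz : z ∈ poincareDisk) :
    ContinuousOn (kernelIntegrand X m n l z) (Metric.sphere 0 1) :=
  (continuousOn_uncurry_kernelIntegrand hX m n l).comp (f := fun x => (z, x)) (by fun_prop)
    fun _ hx => ⟨hz, hx⟩

theorem circleIntegrable_kernelIntegrand {z : ℂ} (hz : z ∈ poincareDisk) :
    CircleIntegrable (kernelIntegrand X m n l z) 0 1 :=
  (continuousOn_kernelIntegrand hX m n l hz).circleIntegrable zero_le_one

omit hX in
theorem hasWirtingerAt_kernelIntegrand {z x : ℂ} (hz : z ∈ poincareDisk)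
    (hx : x ∈ Metric.sphere (0 : ℂ) 1) :
    HasWirtingerAt (fun z => kernelIntegrand X m n l z x)
      (l * kernelIntegrand X m n (l + 1) z x) (n * kernelIntegrand X (m + 1) (n + 1) l z x) z := by
  have h1 := ((((HasWirtingerAt.const 1 z).sub
    ((HasWirtingerAt.star_self z).mul (HasWirtingerAt.const x z))).inv
      (one_sub_conj_mul_ne_zero hz hx)).pow n)
  have h2 := (((HasWirtingerAt.const x z).sub (HasWirtingerAt.self z)).inv
      (sub_ne_zero_of_mem_poincareDisk hz hx)).pow l
  refine ((h1.const_mul (X x * x ^ m)).mul h2).congr_coeff ?_ ?_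
  -- The power rule carries the truncated exponent `l - 1`; at `l = 0` the factor `l` kills the
  -- term.
  · rcases l with _ | l
    · simp
    · simp only [kernelIntegrand, Nat.add_sub_cancel]
      ring
  · rcases n with _ | n
    · simp
    · simp only [kernelIntegrand, Nat.add_sub_cancel]
      ring

theorem hasWirtingerAt_kernelIntegral {z : ℂ} (hz : z ∈ poincareDisk) :
    HasWirtingerAt (kernelIntegral X m n l)
      (l * kernelIntegral X m n (l + 1) z) (n * kernelIntegral X (m + 1) (n + 1) l z) z := by
  have := HasWirtingerAt.circleIntegral isOpen_poincareDisk
    (G := kernelIntegrand X m n l) (P := fun z x => l * kernelIntegrand X m n (l + 1) z x)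
    (Q := fun z x => n * kernelIntegrand X (m + 1) (n + 1) l z x)
    (fun z hz => continuousOn_kernelIntegrand hX m n l hz)
    (continuousOn_const.mul (continuousOn_uncurry_kernelIntegrand hX _ _ _))
    (continuousOn_const.mul (continuousOn_uncurry_kernelIntegrand hX _ _ _))
    (fun z hz x hx => hasWirtingerAt_kernelIntegrand m n l hz hx) hz
  simp only [circleIntegral.integral_const_mul] at this
  exact this

/-- Expanding a factor `1 - z̄x` inserted in numerator and denominator brings integrals with
different exponents to a common kernel; the next lemma does the same with `x - z`. -/
theorem kernelIntegral_eq_sub_conj_mul {z : ℂ} (hz : z ∈ poincareDisk) :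
    kernelIntegral X m n l z =
      kernelIntegral X m (n + 1) l z - conj z * kernelIntegral X (m + 1) (n + 1) l z := by
  unfold kernelIntegral
  rw [← circleIntegral.integral_const_mul, ← circleIntegral.integral_sub
    (g := fun x => conj z * kernelIntegrand X (m + 1) (n + 1) l z x)
    (circleIntegrable_kernelIntegrand hX _ _ _ hz)
    ((continuousOn_const.mul (continuousOn_kernelIntegrand hX _ _ _ hz)).circleIntegrable
      zero_le_one)]
  refine circleIntegral.integral_congr zero_le_one fun x hx => ?_
  have := one_sub_conj_mul_ne_zero hz hx
  simp only [kernelIntegrand, inv_pow]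
  field_simp
  ring

theorem kernelIntegral_eq_sub_mul {z : ℂ} (hz : z ∈ poincareDisk) :
    kernelIntegral X m n l z =
      kernelIntegral X (m + 1) n (l + 1) z - z * kernelIntegral X m n (l + 1) z := by
  unfold kernelIntegral
  rw [← circleIntegral.integral_const_mul, ← circleIntegral.integral_sub
    (g := fun x => z * kernelIntegrand X m n (l + 1) z x)
    (circleIntegrable_kernelIntegrand hX _ _ _ hz)
    ((continuousOn_const.mul (continuousOn_kernelIntegrand hX _ _ _ hz)).circleIntegrable
      zero_le_one)]
  refine circleIntegral.integral_congr zero_le_one fun x hx => ?_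
  have := sub_ne_zero_of_mem_poincareDisk hz hx
  simp only [kernelIntegrand, inv_pow]
  field_simp
  ring

theorem contDiffOn_kernelIntegral : ContDiffOn ℝ ∞ (kernelIntegral X m n l) poincareDisk := by
  rw [contDiffOn_infty]
  intro k
  -- The family of kernel integrals is closed under both Wirtinger derivatives, but the exponents
  -- shift, hence the generalization.
  induction k generalizing m n l with
  | zero =>
    rw [Nat.cast_zero, contDiffOn_zero]
    exact fun z hz => (HasFDerivAt.continuousAt
      (hasWirtingerAt_kernelIntegral hX m n l hz)).continuousWithinAt
  | succ k ih =>
    rw [Nat.cast_succ, contDiffOn_succ_iff_fderiv_of_isOpen isOpen_poincareDisk]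
    refine ⟨fun z hz => (HasFDerivAt.differentiableAt
      (hasWirtingerAt_kernelIntegral hX m n l hz)).differentiableWithinAt, by simp, ?_⟩
    refine ContDiffOn.congr (f := fun z => wirtingerMap (l * kernelIntegral X m n (l + 1) z)
      (n * kernelIntegral X (m + 1) (n + 1) l z)) ?_
      fun z hz => HasFDerivAt.fderiv (hasWirtingerAt_kernelIntegral hX m n l hz)
    exact ((contDiffOn_const.mul (ih _ _ _)).smul contDiffOn_const).add
      ((contDiffOn_const.mul (ih _ _ _)).smul contDiffOn_const)

end

/-! ### Wirtinger derivatives of the infinitesimal Douady–Earle extension -/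

theorem douadyEarle_eq (X : ℂ → ℂ) (z : ℂ) :
    douadyEarle X z =
      (2 * Real.pi * Complex.I)⁻¹ * (1 - z * conj z) ^ 3 * kernelIntegral X 0 3 1 z := by
  unfold douadyEarle kernelIntegral kernelIntegrand
  rw [Complex.mul_conj']
  push_cast
  congr 1
  · ring
  · congr 1
    funext x
    simp only [pow_zero, mul_one, pow_one, div_eq_mul_inv, mul_inv, inv_pow, mul_assoc]

theorem hasWirtingerAt_one_sub_mul_conj (z : ℂ) :
    HasWirtingerAt (fun y => 1 - y * conj y) (-conj z) (-z) z :=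
  ((HasWirtingerAt.const 1 z).sub
    ((HasWirtingerAt.self z).mul (HasWirtingerAt.star_self z))).congr_coeff (by simp) (by simp)

section

variable {X : ℂ → ℂ} (hX : ContinuousOn X (Metric.sphere 0 1))
include hX

theorem contDiffOn_douadyEarle : ContDiffOn ℝ ∞ (douadyEarle X) poincareDisk := by
  rw [funext (douadyEarle_eq X)]
  have h : ContDiff ℝ ∞ fun z : ℂ => conj z := (Complex.conjCLE : ℂ →L[ℝ] ℂ).contDiff
  exact (contDiffOn_const.mul ((contDiffOn_const.sub
    (contDiffOn_id.mul h.contDiffOn)).pow 3)).mul (contDiffOn_kernelIntegral hX 0 3 1)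

/-- The Wirtinger derivatives of `V = douadyEarle X`; `∂V/∂z` is the complex-linear part of `∇V`
minus the Christoffel term `2 z̄ V / (1 - |z|²)`. -/
theorem hasWirtingerAt_douadyEarle {z : ℂ} (hz : z ∈ poincareDisk) :
    HasWirtingerAt (douadyEarle X)
      ((2 * Real.pi * Complex.I)⁻¹ * (1 - z * conj z) ^ 2 * kernelIntegral X 0 2 2 z
        - 2 * conj z * (1 - z * conj z)⁻¹ * douadyEarle X z)
      (3 * (2 * Real.pi * Complex.I)⁻¹ * (1 - z * conj z) ^ 2 * kernelIntegral X 0 4 0 z) z := by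
  have hA := one_sub_mul_conj_ne_zero hz
  have h := (((hasWirtingerAt_one_sub_mul_conj z).pow 3).const_mul
    (2 * Real.pi * Complex.I)⁻¹).mul (hasWirtingerAt_kernelIntegral hX 0 3 1 hz)
  rw [funext (douadyEarle_eq X)]
  refine h.congr_coeff ?_ ?_
  -- On integrands this is `A - z̄ (x - z) = 1 - z̄x`.
  · have e1 := kernelIntegral_eq_sub_conj_mul hX 0 2 2 hz
    have e2 := kernelIntegral_eq_sub_mul hX 0 3 1 hz
    norm_num at e1 e2 ⊢
    rw [e1, e2]
    generalize kernelIntegral X 1 3 2 z = a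
    generalize kernelIntegral X 0 3 2 z = b
    field_simp
    ring
  -- On integrands this is `A x - z (1 - z̄x) = x - z`, which removes the pole at `x = z`.
  · have e1 := kernelIntegral_eq_sub_conj_mul hX 0 3 1 hz
    have e2 := kernelIntegral_eq_sub_mul hX 0 4 0 hz
    norm_num at e1 e2 ⊢
    rw [e1, e2]
    ring

/-- The remaining integral depends on `z̄` alone, so `∂/∂z` only sees the factor `A²`, whose
logarithmic derivative is `-2 z̄ / A`. -/
theorem hasWirtingerAt_dbar_douadyEarle {z : ℂ} (hz : z ∈ poincareDisk) :
    ∃ q, HasWirtingerAt (fun z => 3 * (2 * Real.pi * Complex.I)⁻¹ * (1 - z * conj z) ^ 2 *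
      kernelIntegral X 0 4 0 z)
      (-2 * conj z * (1 - z * conj z)⁻¹ * (3 * (2 * Real.pi * Complex.I)⁻¹ *
        (1 - z * conj z) ^ 2 * kernelIntegral X 0 4 0 z)) q z := by
  have hA := one_sub_mul_conj_ne_zero hz
  have h := (((hasWirtingerAt_one_sub_mul_conj z).pow 2).const_mul
    (3 * (2 * Real.pi * Complex.I)⁻¹)).mul (hasWirtingerAt_kernelIntegral hX 0 4 0 hz)
  refine ⟨_, h.congr_coeff ?_ rfl⟩
  norm_num
  field_simp

end

/-- The integral of a tangent field against `|x - z|⁻⁴` is real. -/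
theorem im_kernelIntegral_of_tangent {X : ℂ → ℂ}
    (hX : ∀ x ∈ Metric.sphere (0 : ℂ) 1, inner ℝ x (X x) = 0) {z : ℂ} (hz : z ∈ poincareDisk) :
    (kernelIntegral X 0 2 2 z).im = 0 := by
  have hreal (θ : ℝ) : deriv (circleMap 0 1) θ • kernelIntegrand X 0 2 2 z (circleMap 0 1 θ) =
      ((-(conj (circleMap 0 1 θ) * X (circleMap 0 1 θ)).im /
        Complex.normSq (circleMap 0 1 θ - z) ^ 2 : ℝ) : ℂ) := by
    have hx : circleMap 0 1 θ ∈ Metric.sphere (0 : ℂ) 1 := circleMap_mem_sphere 0 zero_le_one θ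
    rw [deriv_circleMap]
    generalize circleMap 0 1 θ = x at hx ⊢
    have hxx : x * conj x = 1 := by
      rw [Complex.mul_conj', mem_sphere_zero_iff_norm.mp hx]; simp
    have hre : (conj x * X x).re = 0 := by
      have := hX x hx
      rw [Complex.inner] at this
      simpa [mul_comm] using this
    have hXx : conj x * X x = ((conj x * X x).im : ℂ) * Complex.I := by
      conv_lhs => rw [← Complex.re_add_im (conj x * X x), hre]
      simp
    generalize (conj x * X x).im = t at hXx
    have hXt : X x = x * (t * Complex.I) := by
      rw [← hXx, ← mul_assoc, hxx, one_mul]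
    have hw := sub_ne_zero_of_mem_poincareDisk hz hx
    have hx0 : x ≠ 0 := left_ne_zero_of_mul_eq_one hxx
    have hw' : conj (x - z) ≠ 0 := (map_ne_zero _).mpr hw
    -- On the circle the denominator becomes `x² |x - z|⁴`. Tangency gives `X = i t x` with `t`
    -- real, and `dx = i x dθ`, so the factors of `x` cancel and `-t |x - z|⁻⁴ dθ` is left.
    have hk : 1 - conj z * x = x * conj (x - z) := by
      rw [map_sub, mul_sub, hxx]; ring
    push_cast
    rw [← Complex.mul_conj, kernelIntegrand, hXt, hk, smul_eq_mul]
    field_simp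
    rw [Complex.I_sq]
    ring
  unfold kernelIntegral circleIntegral
  simp only [hreal]
  rw [intervalIntegral.integral_ofReal, Complex.ofReal_im]

/-- The complex-linear part of the covariant differential of `douadyEarle X` is imaginary. -/
theorem re_douadyEarle_linear_part {X : ℂ → ℂ}
    (hX : ∀ x ∈ Metric.sphere (0 : ℂ) 1, inner ℝ x (X x) = 0) {z : ℂ} (hz : z ∈ poincareDisk) :
    ((2 * Real.pi * Complex.I)⁻¹ * (1 - z * conj z) ^ 2 * kernelIntegral X 0 2 2 z).re = 0 := by
  have h := im_kernelIntegral_of_tangent hX hz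
  have e : (2 * Real.pi * Complex.I)⁻¹ * (1 - z * conj z) ^ 2 * kernelIntegral X 0 2 2 z =
      (-((2 * Real.pi)⁻¹ * (1 - ‖z‖ ^ 2) ^ 2 * (kernelIntegral X 0 2 2 z).re) : ℝ) *
        Complex.I := by
    conv_lhs => rw [← Complex.re_add_im (kernelIntegral X 0 2 2 z), h]
    rw [Complex.mul_conj', mul_inv, Complex.inv_I]
    push_cast
    ring
  rw [e, Complex.re_ofReal_mul, Complex.I_re, mul_zero]

/-! ### Levi-Civita connections of the hyperbolic metric and of `𝔾` -/

theorem one_sub_norm_sq_pos {z : ℂ} (hz : z ∈ poincareDisk) : 0 < 1 - ‖z‖ ^ 2 := by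
  have h1 : ‖z‖ < 1 := by simpa [poincareDisk] using hz
  nlinarith [norm_nonneg z]

theorem ofReal_one_sub_norm_sq (z : ℂ) : ((1 - ‖z‖ ^ 2 : ℝ) : ℂ) = 1 - z * conj z := by
  rw [Complex.mul_conj']; push_cast; rfl

theorem complex_inner_eq (v w : ℂ) : inner ℝ v w = v.re * w.re + v.im * w.im := by
  rw [Complex.inner, Complex.mul_re, Complex.conj_re, Complex.conj_im]; ring

theorem hasFDerivAt_inv_one_sub_norm_sq_pow {z : ℂ} (hz : z ∈ poincareDisk) (k : ℕ) :
    HasFDerivAt (fun y : ℂ => ((1 - ‖y‖ ^ 2)⁻¹) ^ k)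
      ((2 * (k : ℝ) * ((1 - ‖z‖ ^ 2)⁻¹) ^ (k + 1)) • innerSL ℝ z) z := by
  have h0 := (one_sub_norm_sq_pos hz).ne'
  have h := ((((hasDerivAt_id' (‖z‖ ^ 2)).const_sub 1).inv h0).pow k).comp_hasFDerivAt z
    (hasStrictFDerivAt_norm_sq z).hasFDerivAt
  refine h.congr_fderiv (ContinuousLinearMap.ext fun a => ?_)
  rcases k with _ | k
  · simp
  · simp only [smul_apply, Pi.inv_apply, Nat.add_sub_cancel, smul_eq_mul,
      neg_neg, one_div, ← inv_pow, nsmul_eq_mul]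
    push_cast
    ring

theorem hypMetric_eq (z v w : ℂ) :
    hypMetric z v w = 4 * ((1 - ‖z‖ ^ 2)⁻¹) ^ 2 * inner ℝ v w := by
  rw [hypMetric, div_eq_mul_inv, inv_pow]

theorem fderiv_hypMetric {z : ℂ} (hz : z ∈ poincareDisk) (v w u : ℂ) :
    fderiv ℝ (fun y => hypMetric y w u) z v =
      16 * ((1 - ‖z‖ ^ 2)⁻¹) ^ 3 * inner ℝ z v * inner ℝ w u := by
  simp only [hypMetric_eq]
  have h := ((hasFDerivAt_inv_one_sub_norm_sq_pow hz 2).const_mul 4).mul_const (inner ℝ w u)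
  rw [h.fderiv]
  simp
  ring

/-- The Christoffel symbols of the hyperbolic metric: `Γ_z(v, w) = 2 z̄ v w / (1 - |z|²)`. -/
theorem christoffel_hypMetric {z : ℂ} (hz : z ∈ poincareDisk) (v w : ℂ) :
    christoffel hypMetric z v w = 2 * conj z * (1 - z * conj z)⁻¹ * (v * w) := by
  have h0 := one_sub_norm_sq_pos hz
  apply christoffel_eq
  · intro a b u
    simp only [hypMetric, inner_sub_left, mul_sub]
  · intro a ha
    have := ha a
    rw [hypMetric, real_inner_self_eq_norm_sq] at this
    have h4 : 4 / (1 - ‖z‖ ^ 2) ^ 2 ≠ 0 := by positivity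
    simpa [h4] using this
  · intro u
    rw [koszulForm, fderiv_hypMetric hz, fderiv_hypMetric hz, fderiv_hypMetric hz, hypMetric_eq,
      ← ofReal_one_sub_norm_sq, ← Complex.ofReal_inv]
    generalize (1 - ‖z‖ ^ 2)⁻¹ = t
    simp
    ring

/-- By metric compatibility the two Christoffel terms add up to the derivative of `g` in the
direction `p.2`. Thus `𝔾` is the linearization of `g`, which is why its Christoffel symbols are
linearized as well. -/
theorem tangentMetric_eq {p : ℂ × ℂ} (hp : p.1 ∈ poincareDisk) (ξ η : ℂ × ℂ) :
    tangentMetric p ξ η =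
      4 * ((1 - ‖p.1‖ ^ 2)⁻¹) ^ 2 * (inner ℝ ξ.1 η.2 + inner ℝ ξ.2 η.1) +
        16 * ((1 - ‖p.1‖ ^ 2)⁻¹) ^ 3 * inner ℝ p.1 p.2 * inner ℝ ξ.1 η.1 := by
  rw [tangentMetric, horPart, horPart, verPart, verPart, christoffel_hypMetric hp,
    christoffel_hypMetric hp, hypMetric_eq, hypMetric_eq, ← ofReal_one_sub_norm_sq,
    ← Complex.ofReal_inv]
  generalize (1 - ‖p.1‖ ^ 2)⁻¹ = t
  simp
  ring

theorem fderiv_tangentMetric {p : ℂ × ℂ} (hp : p.1 ∈ poincareDisk) (ζ ξ η : ℂ × ℂ) :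
    fderiv ℝ (fun y => tangentMetric y ξ η) p ζ =
      16 * ((1 - ‖p.1‖ ^ 2)⁻¹) ^ 3 * inner ℝ p.1 ζ.1 * (inner ℝ ξ.1 η.2 + inner ℝ ξ.2 η.1) +
        (16 * ((1 - ‖p.1‖ ^ 2)⁻¹) ^ 3 * (inner ℝ p.1 ζ.2 + inner ℝ ζ.1 p.2) +
          96 * ((1 - ‖p.1‖ ^ 2)⁻¹) ^ 4 * inner ℝ p.1 ζ.1 * inner ℝ p.1 p.2) *
          inner ℝ ξ.1 η.1 := by
  -- The explicit formula is available only over the open disk, which suffices for a derivative.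
  have hev : (fun y => tangentMetric y ξ η) =ᶠ[nhds p] fun y =>
      4 * ((1 - ‖y.1‖ ^ 2)⁻¹) ^ 2 * (inner ℝ ξ.1 η.2 + inner ℝ ξ.2 η.1) +
        16 * ((1 - ‖y.1‖ ^ 2)⁻¹) ^ 3 * inner ℝ y.1 y.2 * inner ℝ ξ.1 η.1 :=
    Filter.eventually_of_mem
      ((isOpen_poincareDisk.preimage continuous_fst).mem_nhds hp) fun y hy => tangentMetric_eq hy ξ η
  have hpow (k : ℕ) : HasFDerivAt (fun y : ℂ × ℂ => ((1 - ‖y.1‖ ^ 2)⁻¹) ^ k) _ p :=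
    (hasFDerivAt_inv_one_sub_norm_sq_pow hp k).comp p hasFDerivAt_fst
  have h := (((hpow 2).const_mul 4).mul_const (inner ℝ ξ.1 η.2 + inner ℝ ξ.2 η.1)).add
    ((((hpow 3).const_mul 16).mul
      ((hasFDerivAt_fst (𝕜 := ℝ) (p := p)).inner ℝ hasFDerivAt_snd)).mul_const (inner ℝ ξ.1 η.1))
  rw [hev.fderiv_eq]
  erw [h.fderiv]
  simp
  ring

/-- The Christoffel symbols of `𝔾` are the linearization of those of the hyperbolic metric. -/
theorem christoffel_tangentMetric {p : ℂ × ℂ} (hp : p.1 ∈ poincareDisk) (ξ η : ℂ × ℂ) :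
    christoffel tangentMetric p ξ η =
      (2 * conj p.1 * (1 - p.1 * conj p.1)⁻¹ * (ξ.1 * η.1),
        2 * conj p.1 * (1 - p.1 * conj p.1)⁻¹ * (ξ.1 * η.2 + ξ.2 * η.1) +
          (2 * conj p.2 * (1 - p.1 * conj p.1)⁻¹ + 2 * conj p.1 * (conj p.1 * p.2 + p.1 * conj p.2)
            * (1 - p.1 * conj p.1)⁻¹ ^ 2) * (ξ.1 * η.1)) := by
  have h0 := one_sub_norm_sq_pos hp
  have h4 : 4 * ((1 - ‖p.1‖ ^ 2)⁻¹) ^ 2 ≠ 0 := by positivity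
  apply christoffel_eq
  · intro a b u
    simp only [tangentMetric_eq hp, Prod.fst_sub, Prod.snd_sub, inner_sub_left]
    ring
  · intro a ha
    have h1 : a.1 = 0 := by
      -- Horizontal and vertical directions are dual under `𝔾`: a vertical test vector detects
      -- `a.1`, and then `(a.2, 0)` detects `a.2`.
      have := ha (0, a.1)
      rw [tangentMetric_eq hp] at this
      simpa [h4, h0.ne'] using this
    have h2 : a.2 = 0 := by
      have := ha (a.2, 0)
      rw [tangentMetric_eq hp] at this
      simpa [h4, h0.ne', h1] using this
    exact Prod.ext h1 h2
  · intro u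
    rw [koszulForm, fderiv_tangentMetric hp, fderiv_tangentMetric hp, fderiv_tangentMetric hp,
      tangentMetric_eq hp, ← ofReal_one_sub_norm_sq, ← Complex.ofReal_inv]
    generalize (1 - ‖p.1‖ ^ 2)⁻¹ = t
    rw [← Complex.ofReal_pow]
    simp only [complex_inner_eq, Complex.mul_re, Complex.mul_im, Complex.add_re, Complex.add_im,
      Complex.conj_re, Complex.conj_im, Complex.ofReal_re, Complex.ofReal_im, Complex.re_ofNat,
      Complex.im_ofNat]
    ring

/-! ### Rough Laplacian, divergence, tension field and Lagrangian condition in coordinates -/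

theorem HasWirtingerAt.congr_of_mem {f g : ℂ → ℂ} {p q z : ℂ} (h : HasWirtingerAt f p q z)
    (hz : z ∈ poincareDisk) (hfg : ∀ y ∈ poincareDisk, g y = f y) : HasWirtingerAt g p q z :=
  HasFDerivAt.congr_of_eventuallyEq h
    (Filter.eventually_of_mem (isOpen_poincareDisk.mem_nhds hz) hfg)

/-- The vector field `(1 - |z|²)/2 · ε`. -/
def conformalField (ε z : ℂ) : ℂ := 2⁻¹ * (1 - z * conj z) * ε

theorem hypFrame_eq (i : Fin 2) : hypFrame i = conformalField (![1, Complex.I] i) := by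
  funext z
  rw [hypFrame, conformalField, Complex.real_smul, Complex.ofReal_div, ofReal_one_sub_norm_sq]
  push_cast
  ring

theorem conj_conformalField (ε z : ℂ) :
    conj (conformalField ε z) = 2⁻¹ * (1 - z * conj z) * conj ε := by
  simp only [conformalField, map_mul, map_sub, map_inv₀, map_ofNat, map_one, Complex.conj_conj,
    mul_comm z]

theorem hasWirtingerAt_conformalField (ε z : ℂ) :
    HasWirtingerAt (conformalField ε) (-(2⁻¹ * conj z * ε)) (-(2⁻¹ * z * ε)) z :=
  (((hasWirtingerAt_one_sub_mul_conj z).const_mul 2⁻¹).mul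
    (HasWirtingerAt.const ε z)).congr_coeff (by ring) (by ring)

theorem hasWirtingerAt_conj_conformalField (ε z : ℂ) :
    HasWirtingerAt (fun y => conj (conformalField ε y)) (-(2⁻¹ * conj z * conj ε))
      (-(2⁻¹ * z * conj ε)) z := by
  rw [funext (conj_conformalField ε)]
  exact hasWirtingerAt_conformalField (conj ε) z

theorem hasWirtingerAt_christoffel_coeff {z : ℂ} (hz : z ∈ poincareDisk) :
    HasWirtingerAt (fun y => 2 * conj y * (1 - y * conj y)⁻¹)
      (2 * conj z ^ 2 * (1 - z * conj z)⁻¹ ^ 2) (2 * (1 - z * conj z)⁻¹ ^ 2) z := by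
  have hA := one_sub_mul_conj_ne_zero hz
  refine (((HasWirtingerAt.star_self z).const_mul 2).mul
    ((hasWirtingerAt_one_sub_mul_conj z).inv hA)).congr_coeff (by ring) ?_
  field_simp
  ring

theorem covDeriv_hypMetric {V : ℂ → ℂ} {p q z : ℂ} (hz : z ∈ poincareDisk)
    (hV : HasWirtingerAt V p q z) (X : ℂ → ℂ) :
    covDeriv hypMetric X V z =
      p * X z + q * conj (X z) + 2 * conj z * (1 - z * conj z)⁻¹ * (X z * V z) := by
  rw [covDeriv, hV.fderiv_apply, christoffel_hypMetric hz]

/-- Summing a quadratic form in `ε, ε̄` over `ε = 1, i`. -/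
theorem sum_quadratic_frame (a b c : ℂ) :
    ∑ i : Fin 2, (a * (![1, Complex.I] i * ![1, Complex.I] i) +
      b * (![1, Complex.I] i * conj (![1, Complex.I] i)) +
      c * (conj (![1, Complex.I] i) * conj (![1, Complex.I] i))) = 2 * b := by
  simp [Fin.sum_univ_two]
  ring

section

variable {V p q : ℂ → ℂ} (hV : ∀ y ∈ poincareDisk, HasWirtingerAt V (p y) (q y) y)
  {z : ℂ} (hz : z ∈ poincareDisk)
include hV hz

/-- Symmetry of second derivatives: `∂p/∂z̄ = ∂q/∂z` if `p = ∂V/∂z` and `q = ∂V/∂z̄`. -/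
theorem wirtinger_symm (hs : ContDiffAt ℝ 2 V z) {p₁ p₂ q₁ q₂ : ℂ}
    (hp : HasWirtingerAt p p₁ p₂ z) (hq : HasWirtingerAt q q₁ q₂ z) : p₂ = q₁ := by
  -- On the pair `(1, i)` the antisymmetrized second derivative is `2i (p₂ - q₁)`.
  have hsymm := hs.isSymmSndFDerivAt (by simp) 1 Complex.I
  have hd : DifferentiableAt ℝ (fderiv ℝ V) z :=
    (hs.fderiv_right (m := 1) (by norm_num)).differentiableAt (by simp)
  have key (a b : ℂ) : fderiv ℝ (fderiv ℝ V) z a b =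
      (p₁ * a + p₂ * conj a) * b + (q₁ * a + q₂ * conj a) * conj b := by
    have h1 : HasWirtingerAt (fun y => fderiv ℝ V y b) _ _ z :=
      ((hp.mul (HasWirtingerAt.const b z)).add
        (hq.mul (HasWirtingerAt.const (conj b) z))).congr_of_mem hz
        fun y hy => (hV y hy).fderiv_apply b
    have h2 := h1.fderiv_apply a
    rw [fderiv_clm_apply hd (differentiableAt_const b)] at h2
    simp only [fderiv_fun_const, Pi.zero_apply, ContinuousLinearMap.comp_zero, zero_add,
      ContinuousLinearMap.flip_apply] at h2
    rw [h2]
    ring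
  rw [key, key] at hsymm
  simp only [map_one, Complex.conj_I] at hsymm
  have : (p₂ - q₁) * (2 * Complex.I) = 0 := by linear_combination hsymm
  simpa [sub_eq_zero] using this

/-- For the frame vector with constant direction `ε`, each summand is a quadratic form in `ε, ε̄`.
Summing over `ε = 1, i` kills `ε²` and `ε̄²`, so only the mixed coefficient matters. -/
theorem roughLaplacian_eq {p₁ q₁ q₂ : ℂ}
    (hp : HasWirtingerAt p p₁ q₁ z) (hq : HasWirtingerAt q q₁ q₂ z) :
    roughLaplacian V z =
      (1 - z * conj z) ^ 2 * (q₁ + 2 * conj z * (1 - z * conj z)⁻¹ * q z) + V z := by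
  have hA := one_sub_mul_conj_ne_zero hz
  have hterm (ε : ℂ) :
      covDeriv hypMetric (conformalField ε) (covDeriv hypMetric (conformalField ε) V) z -
        covDeriv hypMetric (covDeriv hypMetric (conformalField ε) (conformalField ε)) V z =
      4⁻¹ * (1 - z * conj z) ^ 2 * (p₁ + 2 * (2 * conj z * (1 - z * conj z)⁻¹) * p z +
          2 * conj z ^ 2 * (1 - z * conj z)⁻¹ ^ 2 * V z -
          2 * conj z * (1 - z * conj z)⁻¹ * p z) * (ε * ε) +
        2⁻¹ * ((1 - z * conj z) ^ 2 * (q₁ + 2 * conj z * (1 - z * conj z)⁻¹ * q z) + V z) *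
          (ε * conj ε) +
        4⁻¹ * (1 - z * conj z) ^ 2 * (q₂ - 2 * z * (1 - z * conj z)⁻¹ * q z) *
          (conj ε * conj ε) := by
    have hW : HasWirtingerAt (covDeriv hypMetric (conformalField ε) V) _ _ z :=
      (((hp.mul (hasWirtingerAt_conformalField ε z)).add
        (hq.mul (hasWirtingerAt_conj_conformalField ε z))).add
        ((hasWirtingerAt_christoffel_coeff hz).mul
          ((hasWirtingerAt_conformalField ε z).mul (hV z hz)))).congr_of_mem hz
        fun y hy => covDeriv_hypMetric hy (hV y hy) _
    rw [covDeriv_hypMetric hz hW, covDeriv_hypMetric hz (hV z hz),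
      covDeriv_hypMetric hz (hV z hz),
      covDeriv_hypMetric hz (hasWirtingerAt_conformalField ε z)]
    have hAc : 1 - conj z * z ≠ 0 := by rwa [mul_comm]
    simp only [map_add, map_sub, map_mul, map_neg, map_inv₀, map_one, map_ofNat, Complex.conj_conj,
      conformalField]
    rw [mul_comm (conj z) z]
    field_simp
    ring
  rw [roughLaplacian]
  simp only [hypFrame_eq, hterm]
  rw [sum_quadratic_frame]
  ring

theorem fderiv_toSection (a : ℂ) :
    fderiv ℝ (toSection V) z a = (a, p z * a + q z * conj a) := by
  have h : HasFDerivAt (toSection V) _ z := (hasFDerivAt_id (𝕜 := ℝ) z).prodMk (hV z hz)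
  rw [h.fderiv]
  simp

/-- The horizontal part cancels because the section projects to the identity. The vertical part is
the rough Laplacian plus the Ricci term, which is `-V` in curvature `-1`. -/
theorem tensionField_toSection {p₁ q₁ q₂ : ℂ}
    (hp : HasWirtingerAt p p₁ q₁ z) (hq : HasWirtingerAt q q₁ q₂ z) :
    tensionField tangentMetric (toSection V) z =
      (0, (1 - z * conj z) ^ 2 * (q₁ + 2 * conj z * (1 - z * conj z)⁻¹ * q z)) := by
  have hA := one_sub_mul_conj_ne_zero hz
  have hterm (ε : ℂ) :
      mapHessian hypMetric tangentMetric (toSection V) (conformalField ε) (conformalField ε) z =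
      (0, 4⁻¹ * (1 - z * conj z) ^ 2 * (p₁ + 2 * (2 * conj z * (1 - z * conj z)⁻¹) * p z +
          (2 * conj (V z) * (1 - z * conj z)⁻¹ + 2 * conj z * (conj z * V z + z * conj (V z))
            * (1 - z * conj z)⁻¹ ^ 2) -
          2 * conj z * (1 - z * conj z)⁻¹ * p z) * (ε * ε) +
        2⁻¹ * ((1 - z * conj z) ^ 2 * (q₁ + 2 * conj z * (1 - z * conj z)⁻¹ * q z)) *
          (ε * conj ε) +
        4⁻¹ * (1 - z * conj z) ^ 2 * (q₂ - 2 * z * (1 - z * conj z)⁻¹ * q z) *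
          (conj ε * conj ε)) := by
    have hW : HasWirtingerAt
        (fun y => p y * conformalField ε y + q y * conj (conformalField ε y)) _ _ z :=
      (hp.mul (hasWirtingerAt_conformalField ε z)).add
        (hq.mul (hasWirtingerAt_conj_conformalField ε z))
    have hs : HasFDerivAt (fun y => fderiv ℝ (toSection V) y (conformalField ε y)) _ z :=
      (HasFDerivAt.prodMk (hasWirtingerAt_conformalField ε z) hW).congr_of_eventuallyEq
        (Filter.eventually_of_mem (isOpen_poincareDisk.mem_nhds hz) fun y hy =>
          fderiv_toSection hV hy (conformalField ε y))
    have hz' : (toSection V z).1 ∈ poincareDisk := hz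
    rw [mapHessian, covDerivAlong, hs.fderiv, christoffel_tangentMetric hz',
      fderiv_toSection hV hz, fderiv_toSection hV hz,
      covDeriv_hypMetric hz (hasWirtingerAt_conformalField ε z)]
    have hAc : 1 - conj z * z ≠ 0 := by rwa [mul_comm]
    simp only [ContinuousLinearMap.prod_apply, wirtingerMap_apply, Prod.mk_add_mk, Prod.mk_sub_mk,
      Prod.mk.injEq, toSection]
    refine ⟨by ring, ?_⟩
    simp only [map_add, map_sub, map_mul, map_neg, map_inv₀, map_one, map_ofNat, Complex.conj_conj,
      conformalField]
    rw [mul_comm (conj z) z]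
    field_simp
    ring
  rw [tensionField]
  simp only [hypFrame_eq, hterm]
  ext1
  · rw [Prod.fst_sum]
    simp
  · rw [Prod.snd_sum, sum_quadratic_frame]
    ring

/-- The antilinear part of `∇V` has zero real trace; multiplication by `P` has trace `2 Re P`. -/
theorem hypDiv_eq :
    hypDiv V z = 2 * (p z + 2 * conj z * (1 - z * conj z)⁻¹ * V z).re := by
  have h0 := (one_sub_norm_sq_pos hz).ne'
  have hA := one_sub_mul_conj_ne_zero hz
  have hcov (ε : ℂ) : covDeriv hypMetric (conformalField ε) V z =
      ((2⁻¹ * (1 - ‖z‖ ^ 2) : ℝ) : ℂ) *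
        ((p z + 2 * conj z * (1 - z * conj z)⁻¹ * V z) * ε + q z * conj ε) := by
    rw [covDeriv_hypMetric hz (hV z hz), conj_conformalField, Complex.ofReal_mul,
      ofReal_one_sub_norm_sq, conformalField]
    push_cast
    ring
  have hfield (ε : ℂ) : conformalField ε z = ((2⁻¹ * (1 - ‖z‖ ^ 2) : ℝ) : ℂ) * ε := by
    rw [conformalField, Complex.ofReal_mul, ofReal_one_sub_norm_sq]
    push_cast
    ring
  generalize p z + 2 * conj z * (1 - z * conj z)⁻¹ * V z = P at hcov ⊢
  simp only [hypDiv, hypFrame_eq, hcov, hfield, hypMetric, Fin.sum_univ_two, Matrix.cons_val_zero,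
    Matrix.cons_val_one, complex_inner_eq, Complex.ofReal_re, Complex.ofReal_im,
    Complex.add_re, Complex.add_im, Complex.mul_re, Complex.mul_im, Complex.one_re,
    Complex.one_im, Complex.I_re, Complex.I_im, Complex.conj_re, Complex.conj_im]
  field_simp
  ring

/-- The antilinear part contributes a form symmetric in `a, b` to each term of `Ω`, and these
cancel; an imaginary `P` is skew-adjoint and commutes with `J`, so its terms cancel too. The
dimension is two because a section is an immersion. -/
theorem hasLagrangianTangent
    (hP : (p z + 2 * conj z * (1 - z * conj z)⁻¹ * V z).re = 0) :
    Module.finrank ℝ (LinearMap.range (fderiv ℝ (toSection V) z).toLinearMap) = 2 ∧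
    ∀ a b : ℂ, tangentSymplectic (toSection V z)
      (fderiv ℝ (toSection V) z a) (fderiv ℝ (toSection V) z b) = 0 := by
  constructor
  · rw [LinearMap.finrank_range_of_inj, Complex.finrank_real_complex]
    intro a b hab
    simp only [ContinuousLinearMap.coe_coe, fderiv_toSection hV hz, Prod.mk.injEq] at hab
    exact hab.1
  · intro a b
    rw [fderiv_toSection hV hz, fderiv_toSection hV hz, tangentSymplectic, horPart, horPart,
      verPart, verPart, toSection, christoffel_hypMetric hz, christoffel_hypMetric hz]
    have e (c : ℂ) : p z * c + q z * conj c + 2 * conj z * (1 - z * conj z)⁻¹ * (c * V z) =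
        (p z + 2 * conj z * (1 - z * conj z)⁻¹ * V z) * c + q z * conj c := by ring
    simp only [e, hypMetric, hypJ]
    generalize p z + 2 * conj z * (1 - z * conj z)⁻¹ * V z = P at hP
    simp only [complex_inner_eq, Complex.add_re, Complex.add_im, Complex.mul_re, Complex.mul_im,
      Complex.I_re, Complex.I_im, Complex.conj_re, Complex.conj_im, hP]
    ring

end

end

theorem proposition5p4 (X : ℂ → ℂ) (hX : IsContinuousCircleField X) :
    IsHarmonicLagrangian (douadyEarle X) ∧
      (∀ z ∈ poincareDisk, roughLaplacian (douadyEarle X) z = douadyEarle X z) ∧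
      (∀ z ∈ poincareDisk, hypDiv (douadyEarle X) z = 0) := by
  obtain ⟨hc, ht⟩ := hX
  have hsm := contDiffOn_douadyEarle hc
  -- From here on only these properties of `p` and `q` are used, not their integral formulas.
  obtain ⟨p, q, hV, hP, hq⟩ : ∃ p q : ℂ → ℂ,
      (∀ z ∈ poincareDisk, HasWirtingerAt (douadyEarle X) (p z) (q z) z) ∧
      (∀ z ∈ poincareDisk,
        (p z + 2 * conj z * (1 - z * conj z)⁻¹ * douadyEarle X z).re = 0) ∧
      ∀ z ∈ poincareDisk, ∃ q₂, HasWirtingerAt q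
        (-2 * conj z * (1 - z * conj z)⁻¹ * q z) q₂ z := by
    refine ⟨_, _, fun z hz => hasWirtingerAt_douadyEarle hc hz, fun z hz => ?_,
      fun z hz => hasWirtingerAt_dbar_douadyEarle hc hz⟩
    rw [sub_add_cancel]
    exact re_douadyEarle_linear_part ht hz
  have hder (z) (hz : z ∈ poincareDisk) : ∃ p₁ q₁ q₂, HasWirtingerAt p p₁ q₁ z ∧
      HasWirtingerAt q q₁ q₂ z ∧ q₁ + 2 * conj z * (1 - z * conj z)⁻¹ * q z = 0 := by
    have hs : ContDiffAt ℝ ∞ (douadyEarle X) z := hsm.contDiffAt (isOpen_poincareDisk.mem_nhds hz)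
    obtain ⟨q₂, hq⟩ := hq z hz
    have hd : DifferentiableAt ℝ (fderiv ℝ (douadyEarle X)) z :=
      (hs.fderiv_right (m := 1) (by norm_cast)).differentiableAt (by simp)
    have hd1 (a : ℂ) : DifferentiableAt ℝ (fun y => fderiv ℝ (douadyEarle X) y a) z :=
      hd.clm_apply (differentiableAt_const a)
    -- `p + q` is the derivative of the extension in the direction `1`, and `q` is already known to
    -- be differentiable.
    have hpd : DifferentiableAt ℝ p z := by
      refine ((hd1 1).sub (HasFDerivAt.differentiableAt hq)).congr_of_eventuallyEq
        (Filter.eventually_of_mem (isOpen_poincareDisk.mem_nhds hz) fun y hy => ?_)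
      simp [(hV y hy).fderiv_apply]
    obtain ⟨p₁, p₂, hp⟩ := HasWirtingerAt.of_differentiableAt hpd
    -- Symmetry supplies `∂p/∂z̄` without differentiating `p` explicitly.
    have hpq := wirtinger_symm hV hz (hs.of_le (by norm_cast)) hp hq
    subst hpq
    exact ⟨p₁, _, q₂, hp, hq, by ring⟩
  refine ⟨⟨hsm, ⟨contDiffOn_id.prodMk hsm, fun z hz => ?_⟩, fun z hz => ?_⟩, fun z hz => ?_,
    fun z hz => ?_⟩
  · obtain ⟨p₁, q₁, q₂, hp, hq, h0⟩ := hder z hz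
    rw [tensionField_toSection hV hz hp hq, h0, mul_zero, Prod.mk_zero_zero]
  · exact hasLagrangianTangent hV hz (hP z hz)
  · obtain ⟨p₁, q₁, q₂, hp, hq, h0⟩ := hder z hz
    rw [roughLaplacian_eq hV hz hp hq, h0, mul_zero, zero_add]
  · rw [hypDiv_eq hV hz, hP z hz, mul_zero]
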